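/- Let $H$ be a Hilbert space of finite dimension $d$ over $\mathbb K=\mathbb R$ or $\mathbb C$, with inner product $\langle\cdot|\cdot\rangle$ conjugate-linear in the first argument. Let $v$ be a measure on $H$: a nonnegative real function on the closed subspaces of $H$, countably additive on mutually orthogonal subspaces, with $v(H)=1$. For a nonzero vector $n$ write $v(n)=v(\mathbb K n)$, and put $f(x)=\|x\|^2\,v(x/\|x\|)$ for $x\ne0$, $f(0)=0$. Let $\rho$ be a density matrix of $v$, i.e. a positive semidefinite (in particular Hermitian) operator with $\mathrm{tr}\,\rho=1$ and $v(n)=\langle n|\rho|n\rangle$ for all unit vectors $n$. (By Gleason's theorem every measure has one if $d\ge3$.) Then $v(A)=\mathrm{tr}(\rho P_A)$ for every subspace $A$ with orthogonal projection $P_A$, $f(x)=\langle x|\rho|x\rangle$ for all $x$, and the following hold. (1) Explicit construction, $\mathbb K=\mathbb C$. For all $x,y\in H$, $$\langle x|\rho|y\rangle=\tfrac14\{f(x+y)-f(x-y)\}-\tfrac i4\{f(x+iy)-f(x-iy)\}.$$ For every orthonormal basis $n_1,\dots,n_d$, with $a_{jk}=v\big(\tfrac{n_j+n_k}{\sqrt2}\big)-v\big(\tfrac{n_j-n_k}{\sqrt2}\big)$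 and $b_{jk}=v\big(\tfrac{n_j+in_k}{\sqrt2}\big)-v\big(\tfrac{n_j-in_k}{\sqrt2}\big)$, $$\rho=\sum_j v(n_j)|n_j\rangle\langle n_j|+\tfrac12\sum_{j\ne k}(a_{jk}-i\,b_{jk})|n_j\rangle\langle n_k|$$ $$=\sum_j v(n_j)|n_j\rangle\langle n_j|+\tfrac12\sum_{j<k}a_{jk}\big(|n_j\rangle\langle n_k|+|n_k\rangle\langle n_j|\big)-\tfrac i2\sum_{j<k}b_{jk}\big(|n_j\rangle\langle n_k|-|n_k\rangle\langle n_j|\big).$$ The vectors $n_j$, $(n_j\pm n_k)/\sqrt2$, $(n_j\pm in_k)/\sqrt2$ ($j<k$) are exactly $2d^2-d$ unit vectors, and the values of $v$ on them determine $\rho$ and $v$ among all pairs of a measure and a density matrix of it. (2) Explicit construction, $\mathbb K=\mathbb R$. For all $x,y$, $\langle x|\rho|y\rangle=\tfrac14\{f(x+y)-f(x-y)\}$, and for every orthonormal basis $$\rho=\sum_j v(n_j)|n_j\rangle\langle n_j|+\tfrac12\sum_{j\neq k}a_{jk}|n_j\rangle\langle n_k|=\sum_j v(n_j)|n_j\rangle\langle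 n_j|+\tfrac12\sum_{j<k}a_{jk}\big(|n_j\rangle\langle n_k|+|n_k\rangle\langle n_j|\big).$$ The vectors $n_j$, $(n_j\pm n_k)/\sqrt2$ ($j<k$) are exactly $d^2$ unit vectors, and the values of $v$ on them determine $\rho$ and $v$ in the same sense. (3) Low dimensions. If $d=2$ and $\hat x,\hat y$ is an orthonormal basis, then with $a=v\big(\tfrac{\hat x+\hat y}{\sqrt2}\big)-v\big(\tfrac{\hat x-\hat y}{\sqrt2}\big)$ and $b=v\big(\tfrac{\hat x+i\hat y}{\sqrt2}\big)-v\big(\tfrac{\hat x-i\hat y}{\sqrt2}\big)$, $$\rho=v(\hat x)|\hat x\rangle\langle\hat x|+v(\hat y)|\hat y\rangle\langle\hat y|+\tfrac12a\big(|\hat x\rangle\langle\hat y|+|\hat y\rangle\langle\hat x|\big)-\tfrac i2b\big(|\hat x\rangle\langle\hat y|-|\hat y\rangle\langle\hat x|\big)$$ in the complex case; in the real case the same holds without the last term. In the complex case the matrix of $\rho$ in the basis $\hat x,\hat y$ is $$\tfrac{v(\hat x)+v(\hat y)}2I+\tfrac{v(\hat x)-v(\hat y)}2\sigma_z+\tfrac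 a2\sigma_x+\tfrac b2\sigma_y$$ with the Pauli matrices $\sigma_x,\sigma_y,\sigma_z$. If $d=1$, then $v(n)=1$ for all unit vectors $n$, and $\rho=I$. (4) Implicit construction, $\mathbb K=\mathbb R$ or $\mathbb C$. For every orthonormal family of fewer than $d$ vectors, $v$ attains a maximum on the unit vectors orthogonal to it. Hence one can choose successively $n_1,\dots,n_d$ such that $n_i$ maximizes $v$ among the unit vectors orthogonal to $n_1,\dots,n_{i-1}$. For every such choice, $n_1,\dots,n_d$ is an orthonormal basis, $\rho\,n_i=v(n_i)n_i$ for all $i$, $\rho=\sum_i v(n_i)|n_i\rangle\langle n_i|$, and $v(n_d)$ is the minimum of $v$ over all unit vectors. -/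

import Mathlib

open scoped InnerProductSpace ComplexOrder

noncomputable section

namespace Gleason

/-- A (normalized) Gleason measure on a finite-dimensional Hilbert space: a nonnegative real
function on the subspaces (all of which are closed here) which is countably additive on mutually
orthogonal subspaces and takes the value `1` on the whole space. Finite orthogonal families are
covered by filling up with the zero subspace, which is orthogonal to every subspace. -/
structure IsGleasonMeasure (𝕜 : Type*) [RCLike 𝕜] {H : Type*} [NormedAddCommGroup H]
    [InnerProductSpace 𝕜 H] [FiniteDimensional 𝕜 H] (v : Submodule 𝕜 H → ℝ) : Prop where
  nonneg : ∀ A, 0 ≤ v A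
  additive : ∀ A : ℕ → Submodule 𝕜 H, (∀ i j, i ≠ j → A i ⟂ A j) →
    HasSum (fun i => v (A i)) (v (⨆ i, A i))
  normalized : v ⊤ = 1

section

variable {𝕜 : Type*} [RCLike 𝕜] {H : Type*} [NormedAddCommGroup H] [InnerProductSpace 𝕜 H]

/-- A density matrix: a positive semidefinite (in particular Hermitian) operator of trace one. -/
def IsDensityOperator [FiniteDimensional 𝕜 H] (ρ : H →L[𝕜] H) : Prop :=
  ρ.IsPositive ∧ LinearMap.trace 𝕜 H (ρ : H →ₗ[𝕜] H) = 1

/-- The value `v(n)` of `v` on a vector `n`, i.e. on the line spanned by `n`. -/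
def val (v : Submodule 𝕜 H → ℝ) (n : H) : ℝ := v (Submodule.span 𝕜 {n})

/-- The function `f(x) = ‖x‖² v(x / ‖x‖)` extending `v` from unit vectors to the whole space. -/
def extendedVal (v : Submodule 𝕜 H → ℝ) (x : H) : ℝ :=
  ‖x‖ ^ 2 * val v (((‖x‖ : ℝ) : 𝕜)⁻¹ • x)

variable (𝕜) in
/-- The operator `|x⟩⟨y|`, that is `z ↦ ⟨y, z⟩ x`. -/
def ketBra (x y : H) : H →L[𝕜] H := InnerProductSpace.rankOne 𝕜 x y

variable (𝕜) in
/-- The vector `x / √2`. -/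
def overSqrtTwo (x : H) : H := ((Real.sqrt 2 : ℝ) : 𝕜)⁻¹ • x

/-- `x` is a unit vector orthogonal to the given vectors `n` and maximizes `v` among all unit
vectors orthogonal to them. -/
def IsMaximizerOrthogonalTo (v : Submodule 𝕜 H → ℝ) {m : ℕ} (n : Fin m → H) (x : H) : Prop :=
  ‖x‖ = 1 ∧ (∀ j, ⟪n j, x⟫_𝕜 = 0) ∧
    ∀ y : H, ‖y‖ = 1 → (∀ j, ⟪n j, y⟫_𝕜 = 0) → val v y ≤ val v x

/-- `n` arises by successive maximization: each `n i` maximizes `v` among the unit vectors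
orthogonal to all earlier `n j`. -/
def IsSuccessiveMaximizer (v : Submodule 𝕜 H → ℝ) {d : ℕ} (n : Fin d → H) : Prop :=
  ∀ i : Fin d, IsMaximizerOrthogonalTo v (fun j : Fin i => n (Fin.castLE i.isLt.le j)) (n i)

end

section Complex

variable {H : Type*} [NormedAddCommGroup H] [InnerProductSpace ℂ H] {d : ℕ}

/-- The matrix element built from the values of `v` at `(x ± y)/√2` and `(x ± i y)/√2`. -/
def complexCoeff (v : Submodule ℂ H → ℝ) (x y : H) : ℂ :=
  ((val v (overSqrtTwo ℂ (x + y)) - val v (overSqrtTwo ℂ (x - y)) : ℝ) : ℂ)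
    - Complex.I * ((val v (overSqrtTwo ℂ (x + Complex.I • y))
        - val v (overSqrtTwo ℂ (x - Complex.I • y)) : ℝ) : ℂ)

/-- The explicit reconstruction of the density matrix over `ℂ` in an orthonormal basis. -/
def complexReconstruction (v : Submodule ℂ H → ℝ) (n : OrthonormalBasis (Fin d) ℂ H) :
    H →L[ℂ] H :=
  (∑ j, (val v (n j) : ℂ) • ketBra ℂ (n j) (n j))
    + (1 / 2 : ℂ) • ∑ j, ∑ k with j ≠ k, complexCoeff v (n j) (n k) • ketBra ℂ (n j) (n k)

/-- The manifestly Hermitian form of the complex reconstruction. -/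
def complexReconstructionHermitian (v : Submodule ℂ H → ℝ)
    (n : OrthonormalBasis (Fin d) ℂ H) : H →L[ℂ] H :=
  (∑ j, (val v (n j) : ℂ) • ketBra ℂ (n j) (n j))
    + (1 / 2 : ℂ) • (∑ j, ∑ k with j < k,
        ((val v (overSqrtTwo ℂ (n j + n k)) - val v (overSqrtTwo ℂ (n j - n k)) : ℝ) : ℂ) •
          (ketBra ℂ (n j) (n k) + ketBra ℂ (n k) (n j)))
    - (Complex.I / 2) • (∑ j, ∑ k with j < k,
        ((val v (overSqrtTwo ℂ (n j + Complex.I • n k))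
          - val v (overSqrtTwo ℂ (n j - Complex.I • n k)) : ℝ) : ℂ) •
          (ketBra ℂ (n j) (n k) - ketBra ℂ (n k) (n j)))

/-- The vectors on which the valuation has to be known in the complex case. -/
def complexProbes (n : OrthonormalBasis (Fin d) ℂ H) : Set H :=
  {x | (∃ j, x = n j) ∨ ∃ j k, j < k ∧
    (x = overSqrtTwo ℂ (n j + n k) ∨ x = overSqrtTwo ℂ (n j - n k) ∨
      x = overSqrtTwo ℂ (n j + Complex.I • n k) ∨ x = overSqrtTwo ℂ (n j - Complex.I • n k))}

end Complex

section Real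

variable {H : Type*} [NormedAddCommGroup H] [InnerProductSpace ℝ H] {d : ℕ}

/-- The explicit reconstruction of the density matrix over `ℝ` in an orthonormal basis. -/
def realReconstruction (v : Submodule ℝ H → ℝ) (n : OrthonormalBasis (Fin d) ℝ H) :
    H →L[ℝ] H :=
  (∑ j, val v (n j) • ketBra ℝ (n j) (n j))
    + (1 / 2 : ℝ) • ∑ j, ∑ k with j ≠ k,
        (val v (overSqrtTwo ℝ (n j + n k)) - val v (overSqrtTwo ℝ (n j - n k))) •
          ketBra ℝ (n j) (n k)

/-- The manifestly symmetric form of the real reconstruction. -/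
def realReconstructionSymmetric (v : Submodule ℝ H → ℝ)
    (n : OrthonormalBasis (Fin d) ℝ H) : H →L[ℝ] H :=
  (∑ j, val v (n j) • ketBra ℝ (n j) (n j))
    + (1 / 2 : ℝ) • ∑ j, ∑ k with j < k,
        (val v (overSqrtTwo ℝ (n j + n k)) - val v (overSqrtTwo ℝ (n j - n k))) •
          (ketBra ℝ (n j) (n k) + ketBra ℝ (n k) (n j))

/-- The vectors on which the valuation has to be known in the real case. -/
def realProbes (n : OrthonormalBasis (Fin d) ℝ H) : Set H :=
  {x | (∃ j, x = n j) ∨ ∃ j k, j < k ∧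
    (x = overSqrtTwo ℝ (n j + n k) ∨ x = overSqrtTwo ℝ (n j - n k))}

end Real

/-- The Pauli matrices. -/
def pauliX : Matrix (Fin 2) (Fin 2) ℂ := !![0, 1; 1, 0]

def pauliY : Matrix (Fin 2) (Fin 2) ℂ := !![0, -Complex.I; Complex.I, 0]

def pauliZ : Matrix (Fin 2) (Fin 2) ℂ := !![1, 0; 0, -1]

end Gleason

end

namespace Gleason

section General

variable {𝕜 : Type*} [RCLike 𝕜] {H : Type*} [NormedAddCommGroup H] [InnerProductSpace 𝕜 H]

/-- `ρ` represents `v`: `v(n) = ⟨n|ρ|n⟩` for all unit vectors `n`. -/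
def Represents (v : Submodule 𝕜 H → ℝ) (ρ : H →L[𝕜] H) : Prop :=
  ∀ n : H, ‖n‖ = 1 → ((val v n : ℝ) : 𝕜) = ⟪n, ρ n⟫_𝕜

theorem Represents.val_eq_re {v : Submodule 𝕜 H → ℝ} {ρ : H →L[𝕜] H} (h : Represents v ρ)
    {x : H} (hx : ‖x‖ = 1) : val v x = RCLike.re ⟪x, ρ x⟫_𝕜 := by
  rw [← h x hx, RCLike.ofReal_re]

theorem Represents.extendedVal_eq {v : Submodule 𝕜 H → ℝ} {ρ : H →L[𝕜] H}
    (h : Represents v ρ) (x : H) : ((extendedVal v x : ℝ) : 𝕜) = ⟪x, ρ x⟫_𝕜 := by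
  rcases eq_or_ne x 0 with rfl | hx
  · simp [extendedVal]
  · have hx' : ((‖x‖ : ℝ) : 𝕜) ≠ 0 := by simpa using hx
    rw [extendedVal, RCLike.ofReal_mul, h _ (by
      rw [← RCLike.ofReal_inv]; simpa using norm_smul_inv_norm (𝕜 := 𝕜) hx)]
    simp only [map_smul, inner_smul_left, inner_smul_right, map_inv₀, RCLike.conj_ofReal,
      RCLike.ofReal_pow]
    field_simp

section FiniteDimensional

variable [FiniteDimensional 𝕜 H]

theorem IsGleasonMeasure.bot {v : Submodule 𝕜 H → ℝ} (hv : IsGleasonMeasure 𝕜 v) : v ⊥ = 0 := by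
  have h := hv.additive (fun _ => ⊥) (fun i j _ => Submodule.isOrtho_bot_left)
  exact tendsto_nhds_unique tendsto_const_nhds h.summable.tendsto_atTop_zero

theorem IsGleasonMeasure.iSup_fin {v : Submodule 𝕜 H → ℝ} (hv : IsGleasonMeasure 𝕜 v) {m : ℕ}
    (A : Fin m → Submodule 𝕜 H) (hA : ∀ i j, i ≠ j → A i ⟂ A j) :
    v (⨆ i, A i) = ∑ i, v (A i) := by
  set B : ℕ → Submodule 𝕜 H := fun i => if hi : i < m then A ⟨i, hi⟩ else ⊥ with hB
  have hBA : ∀ i : Fin m, B i = A i := fun i => by simp [hB]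
  have hort : ∀ i j, i ≠ j → B i ⟂ B j := by
    intro i j hij
    by_cases hi : i < m <;> by_cases hj : j < m <;> simp only [hB, hi, hj, dite_true, dite_false]
    · exact hA _ _ (by simpa using hij)
    all_goals simp
  have hsup : ⨆ i, B i = ⨆ i, A i := by
    apply le_antisymm
    · refine iSup_le fun i => ?_
      by_cases hi : i < m
      · simpa [hB, hi] using le_iSup A ⟨i, hi⟩
      · simp [hB, hi]
    · exact iSup_le fun i => hBA i ▸ le_iSup B i
  have hsum := hv.additive B hort
  rw [hsup] at hsum
  rw [hsum.unique (hasSum_sum_of_ne_finset_zero (s := Finset.range m) fun i hi => by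
    simp [hB, Finset.mem_range.not.mp hi, hv.bot]), Finset.sum_range]
  simp [hBA]

theorem IsGleasonMeasure.eq_sum_val {v : Submodule 𝕜 H → ℝ} (hv : IsGleasonMeasure 𝕜 v)
    (A : Submodule 𝕜 H) {m : ℕ} (b : OrthonormalBasis (Fin m) 𝕜 A) :
    v A = ∑ i, val v (b i : H) := by
  have hspan : ⨆ i, Submodule.span 𝕜 {(b i : H)} = A := by
    have h := congrArg (Submodule.map A.subtype) b.toBasis.span_eq
    rw [Submodule.map_span, Submodule.map_top, Submodule.range_subtype, ← Set.range_comp,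
      Submodule.span_range_eq_iSup] at h
    simpa using h
  have h := hv.iSup_fin (fun i => Submodule.span 𝕜 {(b i : H)}) fun i j hij => by
    rw [Submodule.isOrtho_span]
    rintro _ rfl _ rfl
    simpa using b.orthonormal.2 hij
  rw [hspan] at h
  exact h

theorem IsGleasonMeasure.eq_trace {v : Submodule 𝕜 H → ℝ} (hv : IsGleasonMeasure 𝕜 v)
    {ρ : H →L[𝕜] H} (h : Represents v ρ) (A : Submodule 𝕜 H) :
    ((v A : ℝ) : 𝕜) =
      LinearMap.trace 𝕜 H ((ρ ∘L A.starProjection : H →L[𝕜] H) : H →ₗ[𝕜] H) := by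
  have b := stdOrthonormalBasis 𝕜 A
  have hcomp : ρ ∘L A.starProjection =
      ∑ i, InnerProductSpace.rankOne 𝕜 (ρ (b i : H)) (b i : H) := by
    ext x
    simp [b.starProjection_eq_sum_rankOne]
  rw [hcomp, hv.eq_sum_val A b, RCLike.ofReal_sum, ContinuousLinearMap.toLinearMap_sum, map_sum]
  refine Finset.sum_congr rfl fun i _ => ?_
  rw [InnerProductSpace.trace_rankOne]
  exact h _ (b.orthonormal.1 i)

theorem measure_ext {v v' : Submodule 𝕜 H → ℝ} (hv : IsGleasonMeasure 𝕜 v)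
    (hv' : IsGleasonMeasure 𝕜 v') {ρ : H →L[𝕜] H} (h : Represents v ρ) (h' : Represents v' ρ) :
    v' = v := by
  ext A
  exact RCLike.ofReal_injective (K := 𝕜) ((hv'.eq_trace h' A).trans (hv.eq_trace h A).symm)

theorem Represents.exists_isMaximizerOrthogonalTo {v : Submodule 𝕜 H → ℝ} {ρ : H →L[𝕜] H}
    (h : Represents v ρ) {m : ℕ} (hm : m < Module.finrank 𝕜 H) (n : Fin m → H) :
    ∃ x : H, IsMaximizerOrthogonalTo v n x := by
  have : ProperSpace H := FiniteDimensional.proper 𝕜 H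
  set K : Set H := Metric.sphere 0 1 ∩ {x | ∀ j, ⟪n j, x⟫_𝕜 = 0} with hK
  have hclosed : IsClosed {x : H | ∀ j, ⟪n j, x⟫_𝕜 = 0} := by
    simp only [Set.ofPred_forall]
    exact isClosed_iInter fun j => isClosed_eq (by fun_prop) continuous_const
  have hcompact : IsCompact K := (isCompact_sphere 0 1).inter_right hclosed
  have hne : K.Nonempty := by
    have hlt : Module.finrank 𝕜 (Submodule.span 𝕜 (Set.range n)) < Module.finrank 𝕜 H :=
      (finrank_range_le_card n).trans_lt (by simpa using hm)
    have hbot : (Submodule.span 𝕜 (Set.range n))ᗮ ≠ ⊥ := by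
      rw [Ne, Submodule.orthogonal_eq_bot_iff]
      intro htop
      rw [htop, finrank_top] at hlt
      exact hlt.false
    obtain ⟨x, hx, hx0⟩ := Submodule.exists_mem_ne_zero_of_ne_bot hbot
    refine ⟨((‖x‖ : ℝ) : 𝕜)⁻¹ • x, by simpa using norm_smul_inv_norm (𝕜 := 𝕜) hx0, fun j => ?_⟩
    rw [inner_smul_right, Submodule.inner_right_of_mem_orthogonal
      (Submodule.subset_span (Set.mem_range_self j)) hx, mul_zero]
  have hcont : Continuous fun x : H => RCLike.re ⟪x, ρ x⟫_𝕜 := by fun_prop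
  obtain ⟨x, ⟨hx1, hx2⟩, hmax⟩ := hcompact.exists_isMaxOn hne hcont.continuousOn
  rw [mem_sphere_zero_iff_norm] at hx1
  refine ⟨x, hx1, hx2, fun y hy hyn => ?_⟩
  rw [h.val_eq_re hx1, h.val_eq_re hy]
  exact hmax ⟨mem_sphere_zero_iff_norm.mpr hy, hyn⟩

end FiniteDimensional

theorem IsSuccessiveMaximizer.orthonormal {v : Submodule 𝕜 H → ℝ} {d : ℕ} {n : Fin d → H}
    (hn : IsSuccessiveMaximizer v n) : Orthonormal 𝕜 n := by
  have hlt : ∀ i j, j < i → ⟪n j, n i⟫_𝕜 = 0 := fun i j hji => (hn i).2.1 ⟨j, hji⟩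
  refine ⟨fun i => (hn i).1, fun i j hij => ?_⟩
  rcases lt_or_gt_of_ne hij with h | h
  · exact hlt j i h
  · exact inner_eq_zero_symm.mp (hlt i j h)

theorem Represents.exists_isSuccessiveMaximizer [FiniteDimensional 𝕜 H]
    {v : Submodule 𝕜 H → ℝ} {ρ : H →L[𝕜] H} (h : Represents v ρ) :
    ∀ m : ℕ, m ≤ Module.finrank 𝕜 H → ∃ n : Fin m → H, IsSuccessiveMaximizer v n
  | 0, _ => ⟨Fin.elim0, fun i => i.elim0⟩
  | m + 1, hm => by
    obtain ⟨n, hn⟩ := h.exists_isSuccessiveMaximizer m (Nat.le_of_succ_le hm)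
    obtain ⟨x, hx⟩ := h.exists_isMaximizerOrthogonalTo hm n
    refine ⟨Fin.snoc n x, fun i => ?_⟩
    induction i using Fin.lastCases with
    | last =>
      rw [Fin.snoc_last]
      have he : (fun j : Fin m => Fin.snoc (α := fun _ => H) n x
          (Fin.castLE (Fin.last m).isLt.le j)) = n :=
        funext fun j => Fin.snoc_castSucc (α := fun _ => H) x n j
      exact he.symm ▸ hx
    | cast i =>
      rw [Fin.snoc_castSucc]
      have he : (fun j : Fin i => Fin.snoc (α := fun _ => H) n x
          (Fin.castLE i.castSucc.isLt.le j)) = fun j : Fin i => n (Fin.castLE i.isLt.le j) :=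
        funext fun j =>
          Fin.snoc_castSucc (α := fun _ => H) x n (Fin.castLE i.isLt.le j)
      exact he.symm ▸ hn i

/-- A maximizer of the quadratic form of a symmetric operator on the unit vectors of the
orthogonal complement of some of its eigenvectors is again an eigenvector. -/
theorem IsMaximizerOrthogonalTo.eigenvector {v : Submodule 𝕜 H → ℝ} {ρ : H →L[𝕜] H}
    (h : Represents v ρ) (hρ : (ρ : H →ₗ[𝕜] H).IsSymmetric) {m : ℕ} {n : Fin m → H} {c : Fin m → 𝕜}
    (hn : ∀ j, ρ (n j) = c j • n j) {x : H} (hx : IsMaximizerOrthogonalTo v n x) :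
    ρ x = ((val v x : ℝ) : 𝕜) • x := by
  obtain ⟨hx1, hxn, hmax⟩ := hx
  set l : ℝ := val v x with hl
  set w : H := (l : 𝕜) • x - ρ x with hw
  have hwn : ∀ j, ⟪n j, w⟫_𝕜 = 0 := fun j => by
    have hs : ⟪ρ (n j), x⟫_𝕜 = ⟪n j, ρ x⟫_𝕜 := hρ (n j) x
    rw [hw, inner_sub_right, inner_smul_right, hxn, ← hs, hn, inner_smul_left, hxn]
    simp
  set q : H → ℝ := fun y => l * ‖y‖ ^ 2 - RCLike.re ⟪y, ρ y⟫_𝕜 with hq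
  have hq0 : ∀ y, (∀ j, ⟪n j, y⟫_𝕜 = 0) → 0 ≤ q y := by
    intro y hy
    rcases eq_or_ne y 0 with rfl | hy0
    · simp [hq]
    · have hle := hmax (((‖y‖ : ℝ) : 𝕜)⁻¹ • y) (by simpa using norm_smul_inv_norm (𝕜 := 𝕜) hy0)
        fun j => by rw [inner_smul_right, hy, mul_zero]
      have he := h.extendedVal_eq y
      have he' : extendedVal v y = RCLike.re ⟪y, ρ y⟫_𝕜 := by rw [← he, RCLike.ofReal_re]
      rw [hq]
      simp only
      rw [← he', extendedVal, mul_comm l]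
      exact sub_nonneg.mpr (mul_le_mul_of_nonneg_left hle (sq_nonneg _))
  have hexp : ∀ t : ℝ, q (x + (t : 𝕜) • w) = q w * (t * t) + (2 * ‖w‖ ^ 2) * t + 0 := by
    intro t
    have hs : ⟪ρ x, w⟫_𝕜 = ⟪x, ρ w⟫_𝕜 := hρ x w
    have h1 : RCLike.re ⟪x, ρ x⟫_𝕜 = l := (h.val_eq_re hx1).symm
    have h2 : RCLike.re ⟪w, ρ x⟫_𝕜 = l * RCLike.re ⟪x, w⟫_𝕜 - ‖w‖ ^ 2 := by
      have : ρ x = (l : 𝕜) • x - w := by rw [hw]; abel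
      rw [this, inner_sub_right, inner_smul_right, map_sub, RCLike.re_ofReal_mul,
        inner_self_eq_norm_sq, inner_re_symm]
    have h3 : RCLike.re ⟪x, ρ w⟫_𝕜 = RCLike.re ⟪w, ρ x⟫_𝕜 := by rw [← hs, inner_re_symm]
    simp only [hq]
    rw [@norm_add_sq 𝕜, norm_smul, inner_smul_right, RCLike.re_ofReal_mul, hx1]
    simp only [map_add, map_smul, inner_add_left, inner_add_right, inner_smul_left,
      inner_smul_right, RCLike.conj_ofReal, RCLike.re_ofReal_mul, h1, h3, h2, mul_pow,
      RCLike.norm_ofReal, sq_abs]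
    ring
  have hd := discrim_le_zero (a := q w) (b := 2 * ‖w‖ ^ 2) (c := 0) fun t => by
    rw [← hexp t]
    exact hq0 _ fun j => by rw [inner_add_right, inner_smul_right, hxn, hwn]; simp
  have hw0 : ‖w‖ = 0 := by
    rw [discrim, mul_zero, sub_zero] at hd
    simpa using le_antisymm hd (sq_nonneg _)
  exact (sub_eq_zero.mp (norm_eq_zero.mp hw0)).symm

theorem IsSuccessiveMaximizer.eigenvector {v : Submodule 𝕜 H → ℝ} {ρ : H →L[𝕜] H}
    (h : Represents v ρ) (hρ : (ρ : H →ₗ[𝕜] H).IsSymmetric) {d : ℕ} {n : Fin d → H}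
    (hn : IsSuccessiveMaximizer v n) (i : Fin d) : ρ (n i) = ((val v (n i) : ℝ) : 𝕜) • n i := by
  induction i using WellFoundedLT.induction with
  | ind i ih => exact (hn i).eigenvector h hρ fun j => ih _ j.isLt

theorem IsSuccessiveMaximizer.val_last_le {v : Submodule 𝕜 H → ℝ} {ρ : H →L[𝕜] H}
    (h : Represents v ρ) (hρ : (ρ : H →ₗ[𝕜] H).IsSymmetric) {d : ℕ} {n : Fin d → H}
    (hn : IsSuccessiveMaximizer v n) (b : OrthonormalBasis (Fin d) 𝕜 H) (hb : ⇑b = n)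
    {i : Fin d} (hi : (i : ℕ) + 1 = d) {x : H} (hx : ‖x‖ = 1) : val v (n i) ≤ val v x := by
  have hle : ∀ j, val v (n i) ≤ val v (n j) := by
    intro j
    refine (hn j).2.2 _ (hn i).1 fun k => hn.orthonormal.2 fun hk => ?_
    have := congrArg Fin.val hk
    have hkj := k.isLt
    simp only [Fin.val_castLE] at this
    omega
  have hsum : val v x = ∑ j, val v (n j) * ‖⟪b j, x⟫_𝕜‖ ^ 2 := by
    rw [h.val_eq_re hx, ← b.sum_inner_mul_inner, map_sum]
    refine Finset.sum_congr rfl fun j _ => ?_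
    have hs : ⟪ρ (b j), x⟫_𝕜 = ⟪b j, ρ x⟫_𝕜 := hρ (b j) x
    rw [← hs, hb, hn.eigenvector h hρ, inner_smul_left, RCLike.conj_ofReal, mul_left_comm,
      RCLike.re_ofReal_mul, ← inner_conj_symm x (n j), RCLike.conj_mul]
    norm_cast
  have hone : ∑ j, ‖⟪b j, x⟫_𝕜‖ ^ 2 = 1 := by rw [b.sum_sq_norm_inner_right, hx, one_pow]
  rw [hsum, ← mul_one (val v (n i)), ← hone, Finset.mul_sum]
  exact Finset.sum_le_sum fun j _ => mul_le_mul_of_nonneg_right (hle j) (sq_nonneg _)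

end General

end Gleason

namespace Gleason

section SumLemmas

theorem sum_sum_ne_eq_sum_sum_lt {d : ℕ} {M : Type*} [AddCommMonoid M] (F : Fin d → Fin d → M) :
    ∑ j, ∑ k with j ≠ k, F j k = ∑ j, ∑ k with j < k, (F j k + F k j) := by
  have hsplit : ∀ j, ∑ k with j ≠ k, F j k = ∑ k with j < k, F j k + ∑ k with k < j, F j k := by
    intro j
    rw [← Finset.sum_union (Finset.disjoint_filter.mpr fun k _ h => h.not_gt)]
    refine Finset.sum_congr ?_ fun _ _ => rfl
    ext k
    simp
  simp only [hsplit, Finset.sum_add_distrib]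
  congr 1
  simp only [Finset.sum_filter]
  exact Finset.sum_comm

theorem sum_sum_eq_sum_diag_add {d : ℕ} {M : Type*} [AddCommMonoid M] (F : Fin d → Fin d → M) :
    ∑ j, ∑ k, F j k = ∑ j, F j j + ∑ j, ∑ k with j ≠ k, F j k := by
  rw [← Finset.sum_add_distrib]
  refine Finset.sum_congr rfl fun j _ => ?_
  rw [Finset.filter_ne, Finset.add_sum_erase _ _ (Finset.mem_univ j)]

theorem card_lt_pairs (d : ℕ) :
    d + 2 * (Finset.univ.filter fun p : Fin d × Fin d => p.1 < p.2).card = d ^ 2 := by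
  have h := sum_sum_eq_sum_diag_add (d := d) fun _ _ => 1
  rw [sum_sum_ne_eq_sum_sum_lt] at h
  have h' : ∑ j : Fin d, ∑ k : Fin d with j < k, (1 + 1) =
      2 * (Finset.univ.filter fun p : Fin d × Fin d => p.1 < p.2).card := by
    rw [Finset.card_filter, Fintype.sum_prod_type, Finset.mul_sum]
    refine Finset.sum_congr rfl fun j _ => ?_
    rw [Finset.sum_filter, Finset.mul_sum]
    exact Finset.sum_congr rfl fun k _ => by split_ifs <;> rfl
  rw [h'] at h
  simp only [Finset.sum_const, Finset.card_univ, Fintype.card_fin, smul_eq_mul, mul_one] at h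
  rw [sq, h]

end SumLemmas

section General

variable {𝕜 : Type*} [RCLike 𝕜] {H : Type*} [NormedAddCommGroup H] [InnerProductSpace 𝕜 H]
  {d : ℕ}

theorem eq_sum_sum_inner_smul_ketBra (ρ : H →L[𝕜] H) (n : OrthonormalBasis (Fin d) 𝕜 H) :
    ρ = ∑ j, ∑ k, ⟪n j, ρ (n k)⟫_𝕜 • ketBra 𝕜 (n j) (n k) := by
  ext x
  simp only [ketBra, sum_apply, smul_apply,
    InnerProductSpace.rankOne_apply]
  rw [Finset.sum_comm]
  conv_lhs => rw [← n.sum_repr' x, map_sum]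
  refine Finset.sum_congr rfl fun k _ => ?_
  conv_lhs => rw [map_smul, ← n.sum_repr' (ρ (n k)), Finset.smul_sum]
  exact Finset.sum_congr rfl fun j _ => smul_comm _ _ _

theorem sqrt_two_inv_sq (𝕜 : Type*) [RCLike 𝕜] :
    ((Real.sqrt 2 : ℝ) : 𝕜)⁻¹ * ((Real.sqrt 2 : ℝ) : 𝕜)⁻¹ = 1 / 2 := by
  rw [← mul_inv, ← RCLike.ofReal_mul, Real.mul_self_sqrt zero_le_two]
  simp [RCLike.ofReal_ofNat]

theorem norm_overSqrtTwo (n : OrthonormalBasis (Fin d) 𝕜 H) {j k : Fin d} (hjk : j ≠ k) {c : 𝕜}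
    (hc : ‖c‖ = 1) : ‖overSqrtTwo 𝕜 (n j + c • n k)‖ = 1 := by
  have h : ‖n j + c • n k‖ ^ 2 = 2 := by
    rw [@norm_add_sq 𝕜, inner_smul_right, n.orthonormal.2 hjk, norm_smul, hc,
      n.orthonormal.1, n.orthonormal.1]
    norm_num
  rw [overSqrtTwo, norm_smul, norm_inv, RCLike.norm_ofReal, abs_of_nonneg (Real.sqrt_nonneg _),
    ← h, Real.sqrt_sq (norm_nonneg _), inv_mul_cancel₀]
  intro h0
  rw [h0] at h
  norm_num at h

theorem Represents.val_overSqrtTwo {v : Submodule 𝕜 H → ℝ} {ρ : H →L[𝕜] H} (h : Represents v ρ)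
    (n : OrthonormalBasis (Fin d) 𝕜 H) {j k : Fin d} (hjk : j ≠ k) {c : 𝕜} (hc : ‖c‖ = 1) :
    ((val v (overSqrtTwo 𝕜 (n j + c • n k)) : ℝ) : 𝕜) =
      1 / 2 * (⟪n j, ρ (n j)⟫_𝕜 + ⟪n k, ρ (n k)⟫_𝕜) +
      1 / 2 * (c * ⟪n j, ρ (n k)⟫_𝕜 + (starRingEnd 𝕜) c * ⟪n k, ρ (n j)⟫_𝕜) := by
  have hcc : (starRingEnd 𝕜) c * c = 1 := by rw [RCLike.conj_mul, hc]; simp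
  rw [h _ (norm_overSqrtTwo n hjk hc), overSqrtTwo]
  simp only [map_add, map_smul, inner_add_left, inner_add_right, inner_smul_left,
    inner_smul_right, map_inv₀, RCLike.conj_ofReal]
  linear_combination (⟪n j, ρ (n j)⟫_𝕜 + (starRingEnd 𝕜) c * c * ⟪n k, ρ (n k)⟫_𝕜 +
      c * ⟪n j, ρ (n k)⟫_𝕜 + (starRingEnd 𝕜) c * ⟪n k, ρ (n j)⟫_𝕜) * sqrt_two_inv_sq 𝕜 +
    1 / 2 * ⟪n k, ρ (n k)⟫_𝕜 * hcc

theorem Represents.val_sub_val_overSqrtTwo {v : Submodule 𝕜 H → ℝ} {ρ : H →L[𝕜] H}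
    (h : Represents v ρ) (n : OrthonormalBasis (Fin d) 𝕜 H) {j k : Fin d} (hjk : j ≠ k) {c : 𝕜}
    (hc : ‖c‖ = 1) :
    ((val v (overSqrtTwo 𝕜 (n j + c • n k)) - val v (overSqrtTwo 𝕜 (n j - c • n k)) : ℝ) : 𝕜) =
      c * ⟪n j, ρ (n k)⟫_𝕜 + (starRingEnd 𝕜) c * ⟪n k, ρ (n j)⟫_𝕜 := by
  rw [sub_eq_add_neg (n j), ← neg_smul, RCLike.ofReal_sub, h.val_overSqrtTwo n hjk hc,
    h.val_overSqrtTwo n hjk (by rwa [norm_neg]), map_neg]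
  ring

/-- The basis vectors together with all `(n j + c • n k) / √2` with `j < k` and `c ∈ S`. -/
def probes (n : OrthonormalBasis (Fin d) 𝕜 H) (S : Finset 𝕜) : Set H :=
  Set.range n ∪ (fun q : (Fin d × Fin d) × 𝕜 => overSqrtTwo 𝕜 (n q.1.1 + q.2 • n q.1.2)) ''
    (((Finset.univ.filter fun p : Fin d × Fin d => p.1 < p.2) ×ˢ S : Finset _) : Set _)

theorem norm_eq_one_of_mem_probes (n : OrthonormalBasis (Fin d) 𝕜 H) {S : Finset 𝕜}
    (hS : ∀ c ∈ S, ‖c‖ = 1) {x : H} (hx : x ∈ probes n S) : ‖x‖ = 1 := by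
  rcases hx with ⟨j, rfl⟩ | ⟨⟨⟨j, k⟩, c⟩, hq, rfl⟩
  · exact n.orthonormal.1 j
  · simp only [Finset.coe_product, Set.mem_prod, Finset.mem_coe, Finset.mem_filter,
      Finset.mem_univ, true_and] at hq
    exact norm_overSqrtTwo n hq.1.ne (hS c hq.2)

theorem inner_basis_add_smul (n : OrthonormalBasis (Fin d) 𝕜 H) (i j k : Fin d) (c : 𝕜) :
    ⟪n i, n j + c • n k⟫_𝕜 = (if i = j then 1 else 0) + c * (if i = k then 1 else 0) := by
  rw [inner_add_right, inner_smul_right, n.inner_eq_ite, n.inner_eq_ite]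

theorem ncard_probes (n : OrthonormalBasis (Fin d) 𝕜 H) {S : Finset 𝕜} (hS : ∀ c ∈ S, c ≠ 0) :
    (probes n S).ncard =
      d + (Finset.univ.filter fun p : Fin d × Fin d => p.1 < p.2).card * S.card := by
  have hs : ((Real.sqrt 2 : ℝ) : 𝕜)⁻¹ ≠ 0 := by simp
  rw [probes, Set.ncard_union_eq ?_ (Set.finite_range _) ((Finset.finite_toSet _).image _),
    Set.InjOn.ncard_image ?_, Set.ncard_coe_finset, Finset.card_product, ← Set.image_univ,
    Set.ncard_image_of_injective _ n.orthonormal.linearIndependent.injective, Set.ncard_univ, Nat.card_fin]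
  · rintro ⟨⟨j, k⟩, c⟩ hq ⟨⟨j', k'⟩, c'⟩ hq' he
    simp only [Finset.coe_product, Set.mem_prod, Finset.mem_coe, Finset.mem_filter,
      Finset.mem_univ, true_and] at hq hq'
    have he' : n j + c • n k = n j' + c' • n k' := smul_right_injective H hs he
    have hi : ∀ i, _ := fun i => (inner_basis_add_smul n i j k c).symm.trans
      ((congrArg (fun x => ⟪n i, x⟫_𝕜) he').trans (inner_basis_add_smul n i j' k' c'))
    have hc := hS c hq.2
    have hc' := hS c' hq'.2
    have h1 := hi j
    have h2 := hi k
    have h3 := hi j'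
    have h4 := hi k'
    simp only [Prod.mk.injEq]
    grind
  · rw [Set.disjoint_left]
    rintro _ ⟨i, rfl⟩ ⟨⟨⟨j, k⟩, c⟩, hq, he⟩
    simp only [Finset.coe_product, Set.mem_prod, Finset.mem_coe, Finset.mem_filter,
      Finset.mem_univ, true_and] at hq
    have hi : ∀ l, ((Real.sqrt 2 : ℝ) : 𝕜)⁻¹ *
        ((if l = j then 1 else 0) + c * (if l = k then 1 else 0)) = if l = i then 1 else 0 :=
      fun l => by
        rw [← inner_basis_add_smul n l j k c, ← inner_smul_right, ← n.inner_eq_ite]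
        exact congrArg (fun x => ⟪n l, x⟫_𝕜) he
    have hc := hS c hq.2
    have h1 := hi j
    have h2 := hi k
    have hjk := hq.1.ne
    simp only [if_true, hjk, hjk.symm, if_false, mul_zero, add_zero, zero_add, mul_one] at h1 h2
    have hji : j = i := by
      by_contra hne
      rw [if_neg hne] at h1
      exact hs h1
    have hki : k = i := by
      by_contra hne
      rw [if_neg hne] at h2
      exact mul_ne_zero hs hc h2
    exact hjk (hji.trans hki.symm)

end General

section Complex

variable {H : Type*} [NormedAddCommGroup H] [InnerProductSpace ℂ H] {d : ℕ}

theorem complexProbes_eq_probes (n : OrthonormalBasis (Fin d) ℂ H) :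
    complexProbes n = probes n {1, -1, Complex.I, -Complex.I} := by
  ext x
  simp only [complexProbes, probes, Set.mem_ofPred_eq, Set.mem_union, Set.mem_range, Set.mem_image,
    Finset.coe_product, Set.mem_prod, Finset.mem_coe, Finset.mem_filter, Finset.mem_univ,
    true_and, Prod.exists, Finset.mem_insert, Finset.mem_singleton, eq_comm (b := x)]
  refine or_congr Iff.rfl (exists_congr fun j => exists_congr fun k => ?_)
  constructor
  · rintro ⟨hjk, h | h | h | h⟩
    · exact ⟨1, ⟨hjk, by simp⟩, by simpa using h⟩
    · exact ⟨-1, ⟨hjk, by simp⟩, by simpa [sub_eq_add_neg] using h⟩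
    · exact ⟨Complex.I, ⟨hjk, by simp⟩, h⟩
    · exact ⟨-Complex.I, ⟨hjk, by simp⟩, by simpa [sub_eq_add_neg] using h⟩
  · rintro ⟨c, ⟨hjk, rfl | rfl | rfl | rfl⟩, h⟩
    · exact ⟨hjk, .inl (by simpa using h)⟩
    · exact ⟨hjk, .inr (.inl (by simpa [sub_eq_add_neg] using h))⟩
    · exact ⟨hjk, .inr (.inr (.inl h))⟩
    · exact ⟨hjk, .inr (.inr (.inr (by simpa [sub_eq_add_neg] using h)))⟩

theorem norm_eq_one_of_mem_complexProbes (n : OrthonormalBasis (Fin d) ℂ H) {x : H}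
    (hx : x ∈ complexProbes n) : ‖x‖ = 1 := by
  rw [complexProbes_eq_probes] at hx
  exact norm_eq_one_of_mem_probes n (by simp) hx

theorem ncard_complexProbes (n : OrthonormalBasis (Fin d) ℂ H) :
    (complexProbes n).ncard = 2 * d ^ 2 - d := by
  have hcard : ({1, -1, Complex.I, -Complex.I} : Finset ℂ).card = 4 := by
    rw [Finset.card_insert_of_notMem, Finset.card_insert_of_notMem, Finset.card_pair] <;>
      norm_num [Complex.ext_iff]
  rw [complexProbes_eq_probes, ncard_probes n (by simp), hcard]
  have := card_lt_pairs d
  omega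

theorem Represents.complexCoeff_eq {v : Submodule ℂ H → ℝ} {ρ : H →L[ℂ] H}
    (h : Represents v ρ) (n : OrthonormalBasis (Fin d) ℂ H) {j k : Fin d} (hjk : j ≠ k) :
    complexCoeff v (n j) (n k) = 2 * ⟪n j, ρ (n k)⟫_ℂ := by
  have h1 := h.val_sub_val_overSqrtTwo n hjk (c := 1) (by simp)
  have hI := h.val_sub_val_overSqrtTwo n hjk (c := Complex.I) (by simp)
  simp only [one_smul, map_one, Complex.conj_I, RCLike.ofReal_eq_complex_ofReal] at h1 hI
  rw [complexCoeff, h1, hI]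
  linear_combination (⟪n k, ρ (n j)⟫_ℂ - ⟪n j, ρ (n k)⟫_ℂ) * Complex.I_mul_I

theorem Represents.eq_complexReconstruction {v : Submodule ℂ H → ℝ} {ρ : H →L[ℂ] H}
    (h : Represents v ρ) (n : OrthonormalBasis (Fin d) ℂ H) :
    ρ = complexReconstruction v n := by
  conv_lhs => rw [eq_sum_sum_inner_smul_ketBra ρ n, sum_sum_eq_sum_diag_add]
  rw [complexReconstruction, Finset.smul_sum]
  congr 1
  · exact Finset.sum_congr rfl fun j _ => by rw [← h _ (n.orthonormal.1 j)]; rfl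
  · refine Finset.sum_congr rfl fun j _ => ?_
    rw [Finset.smul_sum]
    refine Finset.sum_congr rfl fun k hk => ?_
    rw [h.complexCoeff_eq n (Finset.mem_filter.mp hk).2, smul_smul]
    congr 1
    ring

theorem complexReconstructionHermitian_eq (v : Submodule ℂ H → ℝ)
    (n : OrthonormalBasis (Fin d) ℂ H)
    (hv : ∀ j k, j < k → complexCoeff v (n k) (n j) = star (complexCoeff v (n j) (n k))) :
    complexReconstructionHermitian v n = complexReconstruction v n := by
  rw [complexReconstruction, sum_sum_ne_eq_sum_sum_lt, complexReconstructionHermitian,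
    add_sub_assoc]
  congr 1
  simp only [Finset.smul_sum, ← Finset.sum_sub_distrib]
  refine Finset.sum_congr rfl fun j _ => Finset.sum_congr rfl fun k hk => ?_
  rw [hv j k (Finset.mem_filter.mp hk).2]
  simp only [complexCoeff, star_sub, star_mul', Complex.star_def, Complex.conj_ofReal,
    Complex.conj_I]
  module

theorem Represents.eq_complexReconstructionHermitian {v : Submodule ℂ H → ℝ} {ρ : H →L[ℂ] H}
    (h : Represents v ρ) (hρ : (ρ : H →ₗ[ℂ] H).IsSymmetric) (n : OrthonormalBasis (Fin d) ℂ H) :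
    ρ = complexReconstructionHermitian v n := by
  rw [complexReconstructionHermitian_eq v n, ← h.eq_complexReconstruction n]
  intro j k hjk
  have hs : ⟪ρ (n k), n j⟫_ℂ = ⟪n k, ρ (n j)⟫_ℂ := hρ (n k) (n j)
  rw [h.complexCoeff_eq n hjk.ne, h.complexCoeff_eq n hjk.ne', ← hs, ← inner_conj_symm]
  simp

theorem complexReconstructionHermitian_congr {v v' : Submodule ℂ H → ℝ}
    (n : OrthonormalBasis (Fin d) ℂ H) (hvv : ∀ x ∈ complexProbes n, val v' x = val v x) :
    complexReconstructionHermitian v' n = complexReconstructionHermitian v n := by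
  have hd : ∀ j, val v' (n j) = val v (n j) := fun j => hvv _ (.inl ⟨j, rfl⟩)
  have ha : ∀ j, ∀ k ∈ Finset.univ.filter (j < ·), _ := fun j k hk =>
    And.intro (hvv _ (.inr ⟨j, k, (Finset.mem_filter.mp hk).2, .inl rfl⟩))
      (hvv _ (.inr ⟨j, k, (Finset.mem_filter.mp hk).2, .inr (.inl rfl)⟩))
  have hb : ∀ j, ∀ k ∈ Finset.univ.filter (j < ·), _ := fun j k hk =>
    And.intro (hvv _ (.inr ⟨j, k, (Finset.mem_filter.mp hk).2, .inr (.inr (.inl rfl))⟩))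
      (hvv _ (.inr ⟨j, k, (Finset.mem_filter.mp hk).2, .inr (.inr (.inr rfl))⟩))
  simp only [complexReconstructionHermitian, hd]
  congr 2
  · congr 1
    exact Finset.sum_congr rfl fun j _ => Finset.sum_congr rfl fun k hk => by
      rw [(ha j k hk).1, (ha j k hk).2]
  · exact Finset.sum_congr rfl fun j _ => Finset.sum_congr rfl fun k hk => by
      rw [(hb j k hk).1, (hb j k hk).2]

theorem Represents.complex_polarization {v : Submodule ℂ H → ℝ} {ρ : H →L[ℂ] H}
    (h : Represents v ρ) (x y : H) :
    ⟪x, ρ y⟫_ℂ = ((extendedVal v (x + y) : ℂ) - (extendedVal v (x - y) : ℂ)) / 4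
      - Complex.I * (((extendedVal v (x + Complex.I • y) : ℂ)
        - (extendedVal v (x - Complex.I • y) : ℂ)) / 4) := by
  have he : ∀ z, ((extendedVal v z : ℝ) : ℂ) = ⟪z, ρ z⟫_ℂ := h.extendedVal_eq
  simp only [he, map_add, map_sub, map_smul, inner_add_left, inner_add_right, inner_sub_left,
    inner_sub_right, inner_smul_left, inner_smul_right, Complex.conj_I]
  linear_combination 1 / 2 * (⟪x, ρ y⟫_ℂ - ⟪y, ρ x⟫_ℂ) * Complex.I_mul_I

theorem sum_lt_fin_two {M : Type*} [AddCommMonoid M] (F : Fin 2 → Fin 2 → M) :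
    ∑ j, ∑ k with j < k, F j k = F 0 1 := by
  simp [Finset.sum_filter, Fin.sum_univ_two]

theorem complexReconstructionHermitian_fin_two (v : Submodule ℂ H → ℝ)
    (n : OrthonormalBasis (Fin 2) ℂ H) :
    complexReconstructionHermitian v n = (val v (n 0) : ℂ) • ketBra ℂ (n 0) (n 0)
      + (val v (n 1) : ℂ) • ketBra ℂ (n 1) (n 1)
      + ((1 / 2 : ℂ) * ((val v (overSqrtTwo ℂ (n 0 + n 1))
          - val v (overSqrtTwo ℂ (n 0 - n 1)) : ℝ) : ℂ)) •
          (ketBra ℂ (n 0) (n 1) + ketBra ℂ (n 1) (n 0))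
      - ((Complex.I / 2) * ((val v (overSqrtTwo ℂ (n 0 + Complex.I • n 1))
          - val v (overSqrtTwo ℂ (n 0 - Complex.I • n 1)) : ℝ) : ℂ)) •
          (ketBra ℂ (n 0) (n 1) - ketBra ℂ (n 1) (n 0)) := by
  rw [complexReconstructionHermitian, sum_lt_fin_two, sum_lt_fin_two, Fin.sum_univ_two, smul_smul,
    smul_smul]

theorem Represents.toMatrix_fin_two {v : Submodule ℂ H → ℝ} {ρ : H →L[ℂ] H}
    (h : Represents v ρ) (n : OrthonormalBasis (Fin 2) ℂ H) :
    LinearMap.toMatrix n.toBasis n.toBasis (ρ : H →ₗ[ℂ] H) =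
      (((val v (n 0) + val v (n 1)) / 2 : ℝ) : ℂ) • (1 : Matrix (Fin 2) (Fin 2) ℂ)
      + (((val v (n 0) - val v (n 1)) / 2 : ℝ) : ℂ) • pauliZ
      + (((val v (overSqrtTwo ℂ (n 0 + n 1))
          - val v (overSqrtTwo ℂ (n 0 - n 1))) / 2 : ℝ) : ℂ) • pauliX
      + (((val v (overSqrtTwo ℂ (n 0 + Complex.I • n 1))
          - val v (overSqrtTwo ℂ (n 0 - Complex.I • n 1))) / 2 : ℝ) : ℂ) • pauliY := by
  have h1 := h.val_sub_val_overSqrtTwo n (j := 0) (k := 1) (by simp) (c := 1) (by simp)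
  have hI := h.val_sub_val_overSqrtTwo n (j := 0) (k := 1) (by simp) (c := Complex.I) (by simp)
  have hd : ∀ j, ((val v (n j) : ℝ) : ℂ) = ⟪n j, ρ (n j)⟫_ℂ := fun j => h _ (n.orthonormal.1 j)
  simp only [one_smul, map_one, Complex.conj_I, RCLike.ofReal_eq_complex_ofReal] at h1 hI
  simp only [Complex.ofReal_div _ 2, h1, hI, Complex.ofReal_add, Complex.ofReal_sub (val v (n 0)),
    hd]
  ext i j
  rw [LinearMap.toMatrix_apply, n.coe_toBasis, n.coe_toBasis_repr_apply, n.repr_apply_apply]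
  fin_cases i <;> fin_cases j <;>
    simp [pauliX, pauliY, pauliZ]
  · ring
  · linear_combination 1 / 2 * (⟪n 0, ρ (n 1)⟫_ℂ - ⟪n 1, ρ (n 0)⟫_ℂ) * Complex.I_mul_I
  · linear_combination -1 / 2 * (⟪n 0, ρ (n 1)⟫_ℂ - ⟪n 1, ρ (n 0)⟫_ℂ) * Complex.I_mul_I
  · ring

end Complex

section Real

variable {H : Type*} [NormedAddCommGroup H] [InnerProductSpace ℝ H] {d : ℕ}

theorem realProbes_eq_probes (n : OrthonormalBasis (Fin d) ℝ H) :
    realProbes n = probes n {1, -1} := by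
  ext x
  simp only [realProbes, probes, Set.mem_ofPred_eq, Set.mem_union, Set.mem_range, Set.mem_image,
    Finset.coe_product, Set.mem_prod, Finset.mem_coe, Finset.mem_filter, Finset.mem_univ,
    true_and, Prod.exists, Finset.mem_insert, Finset.mem_singleton, eq_comm (b := x)]
  refine or_congr Iff.rfl (exists_congr fun j => exists_congr fun k => ?_)
  constructor
  · rintro ⟨hjk, h | h⟩
    · exact ⟨1, ⟨hjk, by simp⟩, by simpa using h⟩
    · exact ⟨-1, ⟨hjk, by simp⟩, by simpa [sub_eq_add_neg] using h⟩
  · rintro ⟨c, ⟨hjk, rfl | rfl⟩, h⟩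
    · exact ⟨hjk, .inl (by simpa using h)⟩
    · exact ⟨hjk, .inr (by simpa [sub_eq_add_neg] using h)⟩

theorem norm_eq_one_of_mem_realProbes (n : OrthonormalBasis (Fin d) ℝ H) {x : H}
    (hx : x ∈ realProbes n) : ‖x‖ = 1 := by
  rw [realProbes_eq_probes] at hx
  exact norm_eq_one_of_mem_probes n (by simp) hx

theorem ncard_realProbes (n : OrthonormalBasis (Fin d) ℝ H) :
    (realProbes n).ncard = d ^ 2 := by
  have hcard : ({1, -1} : Finset ℝ).card = 2 := Finset.card_pair (by norm_num)
  rw [realProbes_eq_probes, ncard_probes n (by simp), hcard, mul_comm, card_lt_pairs d]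

theorem Represents.real_val_sub_val {v : Submodule ℝ H → ℝ} {ρ : H →L[ℝ] H}
    (h : Represents v ρ) (hρ : (ρ : H →ₗ[ℝ] H).IsSymmetric) (n : OrthonormalBasis (Fin d) ℝ H)
    {j k : Fin d} (hjk : j ≠ k) :
    val v (overSqrtTwo ℝ (n j + n k)) - val v (overSqrtTwo ℝ (n j - n k)) =
      2 * ⟪n j, ρ (n k)⟫_ℝ := by
  have h1 := h.val_sub_val_overSqrtTwo n hjk (c := 1) (by simp)
  have hs : ⟪ρ (n k), n j⟫_ℝ = ⟪n k, ρ (n j)⟫_ℝ := hρ (n k) (n j)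
  simp only [one_smul, map_one, RCLike.ofReal_real_eq_id, id, one_mul] at h1
  rw [h1, ← hs, real_inner_comm (n j)]
  ring

theorem Represents.eq_realReconstruction {v : Submodule ℝ H → ℝ} {ρ : H →L[ℝ] H}
    (h : Represents v ρ) (hρ : (ρ : H →ₗ[ℝ] H).IsSymmetric) (n : OrthonormalBasis (Fin d) ℝ H) :
    ρ = realReconstruction v n := by
  conv_lhs => rw [eq_sum_sum_inner_smul_ketBra ρ n, sum_sum_eq_sum_diag_add]
  rw [realReconstruction, Finset.smul_sum]
  congr 1
  · exact Finset.sum_congr rfl fun j _ => by rw [← h _ (n.orthonormal.1 j)]; rfl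
  · refine Finset.sum_congr rfl fun j _ => ?_
    rw [Finset.smul_sum]
    refine Finset.sum_congr rfl fun k hk => ?_
    rw [h.real_val_sub_val hρ n (Finset.mem_filter.mp hk).2, smul_smul]
    congr 1
    ring

theorem Represents.eq_realReconstructionSymmetric {v : Submodule ℝ H → ℝ} {ρ : H →L[ℝ] H}
    (h : Represents v ρ) (hρ : (ρ : H →ₗ[ℝ] H).IsSymmetric) (n : OrthonormalBasis (Fin d) ℝ H) :
    ρ = realReconstructionSymmetric v n := by
  conv_lhs => rw [h.eq_realReconstruction hρ n]
  rw [realReconstruction, realReconstructionSymmetric, sum_sum_ne_eq_sum_sum_lt]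
  congr 2
  refine Finset.sum_congr rfl fun j _ => Finset.sum_congr rfl fun k hk => ?_
  have hjk := (Finset.mem_filter.mp hk).2
  have hs : ⟪ρ (n k), n j⟫_ℝ = ⟪n k, ρ (n j)⟫_ℝ := hρ (n k) (n j)
  rw [h.real_val_sub_val hρ n hjk.ne, h.real_val_sub_val hρ n hjk.ne', ← hs,
    real_inner_comm (n j), smul_add]

theorem realReconstructionSymmetric_congr {v v' : Submodule ℝ H → ℝ}
    (n : OrthonormalBasis (Fin d) ℝ H) (hvv : ∀ x ∈ realProbes n, val v' x = val v x) :
    realReconstructionSymmetric v' n = realReconstructionSymmetric v n := by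
  have hd : ∀ j, val v' (n j) = val v (n j) := fun j => hvv _ (.inl ⟨j, rfl⟩)
  simp only [realReconstructionSymmetric, hd]
  congr 2
  exact Finset.sum_congr rfl fun j _ => Finset.sum_congr rfl fun k hk => by
    rw [hvv _ (.inr ⟨j, k, (Finset.mem_filter.mp hk).2, .inl rfl⟩),
      hvv _ (.inr ⟨j, k, (Finset.mem_filter.mp hk).2, .inr rfl⟩)]

theorem Represents.real_polarization {v : Submodule ℝ H → ℝ} {ρ : H →L[ℝ] H}
    (h : Represents v ρ) (hρ : (ρ : H →ₗ[ℝ] H).IsSymmetric) (x y : H) :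
    ⟪x, ρ y⟫_ℝ = (extendedVal v (x + y) - extendedVal v (x - y)) / 4 := by
  have he : ∀ z, extendedVal v z = ⟪z, ρ z⟫_ℝ := h.extendedVal_eq
  have hs : ⟪ρ x, y⟫_ℝ = ⟪x, ρ y⟫_ℝ := hρ x y
  simp only [he, map_add, map_sub, inner_add_left, inner_add_right, inner_sub_left,
    inner_sub_right]
  rw [← hs, real_inner_comm y]
  ring

theorem realReconstructionSymmetric_fin_two (v : Submodule ℝ H → ℝ)
    (n : OrthonormalBasis (Fin 2) ℝ H) :
    realReconstructionSymmetric v n = val v (n 0) • ketBra ℝ (n 0) (n 0)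
      + val v (n 1) • ketBra ℝ (n 1) (n 1)
      + ((1 / 2 : ℝ) * (val v (overSqrtTwo ℝ (n 0 + n 1))
          - val v (overSqrtTwo ℝ (n 0 - n 1)))) •
          (ketBra ℝ (n 0) (n 1) + ketBra ℝ (n 1) (n 0)) := by
  rw [realReconstructionSymmetric, sum_lt_fin_two, Fin.sum_univ_two, smul_smul]

end Real

section General

variable {𝕜 : Type*} [RCLike 𝕜] {H : Type*} [NormedAddCommGroup H] [InnerProductSpace 𝕜 H]

theorem eq_sum_smul_ketBra_of_eigenvectors {ι : Type*} [Fintype ι] (b : OrthonormalBasis ι 𝕜 H)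
    {ρ : H →L[𝕜] H} {c : ι → 𝕜} (h : ∀ i, ρ (b i) = c i • b i) :
    ρ = ∑ i, c i • ketBra 𝕜 (b i) (b i) := by
  ext x
  simp only [ketBra, sum_apply, smul_apply,
    InnerProductSpace.rankOne_apply]
  conv_lhs => rw [← b.sum_repr' x, map_sum]
  exact Finset.sum_congr rfl fun i _ => by rw [map_smul, h, smul_comm]

theorem IsSuccessiveMaximizer.spectral [FiniteDimensional 𝕜 H] {v : Submodule 𝕜 H → ℝ}
    {ρ : H →L[𝕜] H} (h : Represents v ρ) (hρ : (ρ : H →ₗ[𝕜] H).IsSymmetric) {d : ℕ}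
    (hd : Module.finrank 𝕜 H = d) {n : Fin d → H} (hn : IsSuccessiveMaximizer v n) :
    Orthonormal 𝕜 n ∧ Submodule.span 𝕜 (Set.range n) = ⊤ ∧
      (∀ i, ρ (n i) = ((val v (n i) : ℝ) : 𝕜) • n i) ∧
      ρ = ∑ i, ((val v (n i) : ℝ) : 𝕜) • ketBra 𝕜 (n i) (n i) ∧
      (∀ i : Fin d, (i : ℕ) + 1 = d → ∀ x : H, ‖x‖ = 1 → val v (n i) ≤ val v x) := by
  have hspan : Submodule.span 𝕜 (Set.range n) = ⊤ :=
    hn.orthonormal.linearIndependent.span_eq_top_of_card_eq_finrank' (by simp [hd])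
  have hb := OrthonormalBasis.coe_mk hn.orthonormal hspan.ge
  refine ⟨hn.orthonormal, hspan, hn.eigenvector h hρ, ?_,
    fun i hi x hx => hn.val_last_le h hρ _ hb hi hx⟩
  have he := eq_sum_smul_ketBra_of_eigenvectors (OrthonormalBasis.mk hn.orthonormal hspan.ge)
    (ρ := ρ) (c := fun i => ((val v (n i) : ℝ) : 𝕜)) (by rw [hb]; exact hn.eigenvector h hρ)
  rwa [hb] at he

theorem IsGleasonMeasure.of_finrank_one [FiniteDimensional 𝕜 H] {v : Submodule 𝕜 H → ℝ}
    (hv : IsGleasonMeasure 𝕜 v) {ρ : H →L[𝕜] H} (h : Represents v ρ)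
    (hd : Module.finrank 𝕜 H = 1) :
    (∀ x : H, ‖x‖ = 1 → val v x = 1) ∧ ρ = ContinuousLinearMap.id 𝕜 H := by
  have hval : ∀ x : H, ‖x‖ = 1 → val v x = 1 := fun x hx => by
    rw [val, (finrank_eq_one_iff_of_nonzero x (norm_ne_zero_iff.mp (by simp [hx]))).mp hd,
      hv.normalized]
  refine ⟨hval, ?_⟩
  have b := (stdOrthonormalBasis 𝕜 H).reindex (finCongr hd)
  rw [eq_sum_sum_inner_smul_ketBra ρ b,
    eq_sum_sum_inner_smul_ketBra (ContinuousLinearMap.id 𝕜 H) b]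
  simp [← h _ (b.orthonormal.1 0), hval _ (b.orthonormal.1 0)]

end General

end Gleason

theorem mainTheorem2 :
    -- Over `ℝ` and over `ℂ`: trace formula, quadratic form, implicit construction, dimension one.
    (∀ (𝕜 : Type*) [RCLike 𝕜] (H : Type*) [NormedAddCommGroup H] [InnerProductSpace 𝕜 H]
      [FiniteDimensional 𝕜 H] (d : ℕ) (_ : Module.finrank 𝕜 H = d)
      (v : Submodule 𝕜 H → ℝ) (_ : Gleason.IsGleasonMeasure 𝕜 v)
      (ρ : H →L[𝕜] H) (_ : Gleason.IsDensityOperator ρ)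
      (_ : ∀ n : H, ‖n‖ = 1 → ((Gleason.val v n : ℝ) : 𝕜) = ⟪n, ρ n⟫_𝕜),
      (∀ A : Submodule 𝕜 H, ((v A : ℝ) : 𝕜) =
        LinearMap.trace 𝕜 H ((ρ ∘L A.starProjection : H →L[𝕜] H) : H →ₗ[𝕜] H)) ∧
      (∀ x : H, ((Gleason.extendedVal v x : ℝ) : 𝕜) = ⟪x, ρ x⟫_𝕜) ∧
      -- each step of the successive maximization can be carried out, so it can be completed
      (∀ m : ℕ, m < d → ∀ n : Fin m → H, Orthonormal 𝕜 n →
        ∃ x : H, Gleason.IsMaximizerOrthogonalTo v n x) ∧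
      (∃ n : Fin d → H, Gleason.IsSuccessiveMaximizer v n) ∧
      -- every outcome of it is an orthonormal eigenbasis and gives the density matrix
      (∀ n : Fin d → H, Gleason.IsSuccessiveMaximizer v n →
        Orthonormal 𝕜 n ∧ Submodule.span 𝕜 (Set.range n) = ⊤ ∧
        (∀ i, ρ (n i) = ((Gleason.val v (n i) : ℝ) : 𝕜) • n i) ∧
        ρ = ∑ i, ((Gleason.val v (n i) : ℝ) : 𝕜) • Gleason.ketBra 𝕜 (n i) (n i) ∧
        (∀ i : Fin d, (i : ℕ) + 1 = d → ∀ x : H, ‖x‖ = 1 →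
          Gleason.val v (n i) ≤ Gleason.val v x)) ∧
      (d = 1 → (∀ x : H, ‖x‖ = 1 → Gleason.val v x = 1) ∧ ρ = ContinuousLinearMap.id 𝕜 H)) ∧
    -- Explicit construction, complex case.
    (∀ (H : Type*) [NormedAddCommGroup H] [InnerProductSpace ℂ H]
      [FiniteDimensional ℂ H] (d : ℕ)
      (v : Submodule ℂ H → ℝ) (_ : Gleason.IsGleasonMeasure ℂ v)
      (ρ : H →L[ℂ] H) (_ : Gleason.IsDensityOperator ρ)
      (_ : ∀ n : H, ‖n‖ = 1 → ((Gleason.val v n : ℝ) : ℂ) = ⟪n, ρ n⟫_ℂ),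
      (∀ x y : H, ⟪x, ρ y⟫_ℂ =
        ((Gleason.extendedVal v (x + y) : ℂ) - (Gleason.extendedVal v (x - y) : ℂ)) / 4
          - Complex.I * (((Gleason.extendedVal v (x + Complex.I • y) : ℂ)
            - (Gleason.extendedVal v (x - Complex.I • y) : ℂ)) / 4)) ∧
      (∀ n : OrthonormalBasis (Fin d) ℂ H,
        ρ = Gleason.complexReconstruction v n ∧
        ρ = Gleason.complexReconstructionHermitian v n ∧
        -- the number of unit vectors used, and the values of `v` on them determine everything
        (∀ x ∈ Gleason.complexProbes n, ‖x‖ = 1) ∧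
        (Gleason.complexProbes n).ncard = 2 * d ^ 2 - d ∧
        (∀ (v' : Submodule ℂ H → ℝ) (_ : Gleason.IsGleasonMeasure ℂ v')
          (ρ' : H →L[ℂ] H) (_ : Gleason.IsDensityOperator ρ')
          (_ : ∀ n : H, ‖n‖ = 1 → ((Gleason.val v' n : ℝ) : ℂ) = ⟪n, ρ' n⟫_ℂ),
          (∀ x ∈ Gleason.complexProbes n, Gleason.val v' x = Gleason.val v x) →
            ρ' = ρ ∧ v' = v)) ∧
      -- dimension two
      (∀ n : OrthonormalBasis (Fin 2) ℂ H,
        ρ = (Gleason.val v (n 0) : ℂ) • Gleason.ketBra ℂ (n 0) (n 0)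
          + (Gleason.val v (n 1) : ℂ) • Gleason.ketBra ℂ (n 1) (n 1)
          + ((1 / 2 : ℂ) * ((Gleason.val v (Gleason.overSqrtTwo ℂ (n 0 + n 1))
              - Gleason.val v (Gleason.overSqrtTwo ℂ (n 0 - n 1)) : ℝ) : ℂ)) •
              (Gleason.ketBra ℂ (n 0) (n 1) + Gleason.ketBra ℂ (n 1) (n 0))
          - ((Complex.I / 2) *
              ((Gleason.val v (Gleason.overSqrtTwo ℂ (n 0 + Complex.I • n 1))
              - Gleason.val v (Gleason.overSqrtTwo ℂ (n 0 - Complex.I • n 1)) : ℝ) : ℂ)) •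
              (Gleason.ketBra ℂ (n 0) (n 1) - Gleason.ketBra ℂ (n 1) (n 0)) ∧
        LinearMap.toMatrix n.toBasis n.toBasis (ρ : H →ₗ[ℂ] H) =
          (((Gleason.val v (n 0) + Gleason.val v (n 1)) / 2 : ℝ) : ℂ) •
              (1 : Matrix (Fin 2) (Fin 2) ℂ)
          + (((Gleason.val v (n 0) - Gleason.val v (n 1)) / 2 : ℝ) : ℂ) • Gleason.pauliZ
          + (((Gleason.val v (Gleason.overSqrtTwo ℂ (n 0 + n 1))
              - Gleason.val v (Gleason.overSqrtTwo ℂ (n 0 - n 1))) / 2 : ℝ) : ℂ) •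
              Gleason.pauliX
          + (((Gleason.val v (Gleason.overSqrtTwo ℂ (n 0 + Complex.I • n 1))
              - Gleason.val v (Gleason.overSqrtTwo ℂ (n 0 - Complex.I • n 1))) / 2 : ℝ) : ℂ) •
              Gleason.pauliY)) ∧
    -- Explicit construction, real case.
    (∀ (H : Type*) [NormedAddCommGroup H] [InnerProductSpace ℝ H]
      [FiniteDimensional ℝ H] (d : ℕ)
      (v : Submodule ℝ H → ℝ) (_ : Gleason.IsGleasonMeasure ℝ v)
      (ρ : H →L[ℝ] H) (_ : Gleason.IsDensityOperator ρ)
      (_ : ∀ n : H, ‖n‖ = 1 → Gleason.val v n = ⟪n, ρ n⟫_ℝ),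
      (∀ x y : H, ⟪x, ρ y⟫_ℝ =
        (Gleason.extendedVal v (x + y) - Gleason.extendedVal v (x - y)) / 4) ∧
      (∀ n : OrthonormalBasis (Fin d) ℝ H,
        ρ = Gleason.realReconstruction v n ∧
        ρ = Gleason.realReconstructionSymmetric v n ∧
        (∀ x ∈ Gleason.realProbes n, ‖x‖ = 1) ∧
        (Gleason.realProbes n).ncard = d ^ 2 ∧
        (∀ (v' : Submodule ℝ H → ℝ) (_ : Gleason.IsGleasonMeasure ℝ v')
          (ρ' : H →L[ℝ] H) (_ : Gleason.IsDensityOperator ρ')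
          (_ : ∀ n : H, ‖n‖ = 1 → Gleason.val v' n = ⟪n, ρ' n⟫_ℝ),
          (∀ x ∈ Gleason.realProbes n, Gleason.val v' x = Gleason.val v x) →
            ρ' = ρ ∧ v' = v)) ∧
      -- dimension two
      (∀ n : OrthonormalBasis (Fin 2) ℝ H,
        ρ = Gleason.val v (n 0) • Gleason.ketBra ℝ (n 0) (n 0)
          + Gleason.val v (n 1) • Gleason.ketBra ℝ (n 1) (n 1)
          + ((1 / 2 : ℝ) * (Gleason.val v (Gleason.overSqrtTwo ℝ (n 0 + n 1))
              - Gleason.val v (Gleason.overSqrtTwo ℝ (n 0 - n 1)))) •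
              (Gleason.ketBra ℝ (n 0) (n 1) + Gleason.ketBra ℝ (n 1) (n 0)))) := by
  refine ⟨?_, ?_, ?_⟩
  · intro 𝕜 _ H _ _ _ d hd v hv ρ hρ h
    refine ⟨hv.eq_trace h, Gleason.Represents.extendedVal_eq h,
      fun m hm n _ => Gleason.Represents.exists_isMaximizerOrthogonalTo h (hd ▸ hm) n,
      Gleason.Represents.exists_isSuccessiveMaximizer h d hd.ge,
      fun n hn => hn.spectral h hρ.1.isSymmetric hd,
      fun h1 => hv.of_finrank_one h (hd.trans h1)⟩
  · intro H _ _ _ d v hv ρ hρ h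
    have h : Gleason.Represents v ρ := h
    have hs := hρ.1.isSymmetric
    refine ⟨h.complex_polarization, fun n => ⟨h.eq_complexReconstruction n,
      h.eq_complexReconstructionHermitian hs n,
      fun x hx => Gleason.norm_eq_one_of_mem_complexProbes n hx, Gleason.ncard_complexProbes n,
      fun v' hv' ρ' hρ' h' hvv => ?_⟩, fun n => ⟨?_, h.toMatrix_fin_two n⟩⟩
    · have h' : Gleason.Represents v' ρ' := h'
      obtain rfl : ρ' = ρ := by
        rw [h.eq_complexReconstructionHermitian hs n,
          h'.eq_complexReconstructionHermitian hρ'.1.isSymmetric n,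
          Gleason.complexReconstructionHermitian_congr n hvv]
      exact ⟨rfl, Gleason.measure_ext hv hv' h h'⟩
    · rw [← Gleason.complexReconstructionHermitian_fin_two]
      exact h.eq_complexReconstructionHermitian hs n
  · intro H _ _ _ d v hv ρ hρ h
    have h : Gleason.Represents v ρ := h
    have hs := hρ.1.isSymmetric
    refine ⟨h.real_polarization hs, fun n => ⟨h.eq_realReconstruction hs n,
      h.eq_realReconstructionSymmetric hs n,
      fun x hx => Gleason.norm_eq_one_of_mem_realProbes n hx, Gleason.ncard_realProbes n,
      fun v' hv' ρ' hρ' h' hvv => ?_⟩, fun n => ?_⟩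
    · have h' : Gleason.Represents v' ρ' := h'
      obtain rfl : ρ' = ρ := by
        rw [h.eq_realReconstructionSymmetric hs n,
          h'.eq_realReconstructionSymmetric hρ'.1.isSymmetric n,
          Gleason.realReconstructionSymmetric_congr n hvv]
      exact ⟨rfl, Gleason.measure_ext hv hv' h h'⟩
    · rw [← Gleason.realReconstructionSymmetric_fin_two]
      exact h.eq_realReconstructionSymmetric hs n
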